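/- Let $\mathbb T=\mathbb R/\mathbb Z$ and let $G=\mathbb Z^a\times\mathbb T^b\times\mathbb Z_{N_1}\times\cdots\times\mathbb Z_{N_c}$ ($N_i\ge 1$), with $G^*=\mathbb T^a\times\mathbb Z^b\times\mathbb Z_{N_1}\times\cdots\times\mathbb Z_{N_c}$. The character of $G$ with label $\mu=(p,m,f)\in G^*$ is $\chi_\mu(n,t,x)=\exp\bigl(2\pi i(\sum_i p_in_i+\sum_j m_jt_j+\sum_k f_kx_k/N_k)\bigr)$. A (not necessarily normalizable) state $|\psi\rangle=\int\psi(g)\,|g\rangle\,dg$ in the basis $\{|g\rangle:g\in G\}$ is given by its wavefunction, i.e. its coefficients $\psi:G\to\mathbb C$, and $\operatorname{supp}|\psi\rangle=\{x\in G:\psi(x)\ne 0\}$. Put $(X(g)\psi)(x)=\psi(x-g)$ and $(Z(\mu)\psi)(x)=\chi_\mu(x)\psi(x)$, so that $X(g)|h\rangle=|g+h\rangle$ and $Z(\mu)|h\rangle=\chi_\mu(h)|h\rangle$; the Pauli operators of $G$ are the operators $\gamma Z(\mu)X(g)$ with $\gamma\in\mathbb C$, $|\gamma|=1$, $\mu\in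 G^*$, $g\in G$. A stabilizer group $\mathcal S$ is a group of commuting Pauli operators that fix a common nonzero wavefunction. A nonzero wavefunction $\psi$ is a stabilizer state with stabilizer group $\mathcal S$ if $\sigma\psi=\psi$ for all $\sigma\in\mathcal S$ and every wavefunction fixed by all of $\mathcal S$ is a scalar multiple of $\psi$. Put $$\mathbb H=\{g\in G:\ \gamma Z(\mu)X(g)\in\mathcal S\text{ for some }\gamma,\mu\},\qquad \mathbb D=\{\mu\in G^*:\ \gamma Z(\mu)\in\mathcal S\text{ for some }\gamma\};$$ these are subgroups of $G$ and $G^*$. Let $\psi$ be a stabilizer state with stabilizer group $\mathcal S$. Then: 1. $\psi$ is a uniform superposition over a coset of $\mathbb H$: there are $s\in G$ and $r>0$ with $\operatorname{supp}|\psi\rangle=s+\mathbb H$ and $|\psi(s+h)|=r$ for all $h\in\mathbb H$. 2. For every $x\in G$: $x\in\operatorname{supp}|\psi\rangle$ if and only if $D|x\rangle=|x\rangle$ for every diagonal Pauli operator $D=\gamma Z(\mu)\in\mathcal S$. 3. For each $\mu\in\mathbb D$ there is exactly one phase $\gamma_\mu$ with $\gamma_\mu Z(\mu)\in\mathcal S$,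 and $$\operatorname{supp}|\psi\rangle=\{x\in G:\ \chi_\mu(x)=\overline{\gamma_\mu}\text{ for all }\mu\in\mathbb D\}.$$ 4. $\mathbb H=\mathbb D^\perp:=\{x\in G:\chi_\mu(x)=1\text{ for all }\mu\in\mathbb D\}$, and both $\mathbb H$ and $\operatorname{supp}|\psi\rangle$ are closed in $G$. -/

import Mathlib

open scoped ComplexConjugate Pointwise

noncomputable section

namespace AbelianStabilizer

/-- The circle group `𝕋 = ℝ/ℤ`, written additively. -/
abbrev Torus : Type := AddCircle (1 : ℝ)

/-- The group `ℤ^a × 𝕋^b × ℤ_{N₁} × ⋯ × ℤ_{N_c}` with its usual (product) topology. -/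
abbrev Grp (a b : ℕ) {c : ℕ} (N : Fin c → ℕ) : Type :=
  (Fin a → ℤ) × (Fin b → Torus) × ((i : Fin c) → ZMod (N i))

/-- The label group `G^* = 𝕋^a × ℤ^b × ℤ_{N₁} × ⋯ × ℤ_{N_c}` of the characters of
`G = ℤ^a × 𝕋^b × ℤ_{N₁} × ⋯ × ℤ_{N_c}`. -/
abbrev DualGrp (a b : ℕ) {c : ℕ} (N : Fin c → ℕ) : Type :=
  (Fin a → Torus) × (Fin b → ℤ) × ((i : Fin c) → ZMod (N i))

variable {a b c : ℕ} {N : Fin c → ℕ} [∀ i, NeZero (N i)]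

/-- The character `χ_μ(g) = exp (2πi (∑ pᵢ nᵢ + ∑ mⱼ tⱼ + ∑ fₖ xₖ / Nₖ))` of
`g = (n, t, x) ∈ G` with label `μ = (p, m, f) ∈ G^*`. -/
def chi (μ : DualGrp a b N) (g : Grp a b N) : Circle :=
  (∏ i, AddCircle.toCircle (g.1 i • μ.1 i)) *
    (∏ j, AddCircle.toCircle (μ.2.1 j • g.2.1 j)) *
    ∏ k, ZMod.toCircle (μ.2.2 k * g.2.2 k)

lemma chi_zero_left (g : Grp a b N) : chi (0 : DualGrp a b N) g = 1 := by
  simp [chi]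

lemma chi_zero_right (μ : DualGrp a b N) : chi μ 0 = 1 := by
  simp [chi]

lemma chi_add_left (μ ν : DualGrp a b N) (g : Grp a b N) :
    chi (μ + ν) g = chi μ g * chi ν g := by
  simp only [chi, Prod.fst_add, Prod.snd_add, Pi.add_apply, smul_add, add_smul, add_mul,
    AddCircle.toCircle_add, AddChar.map_add_eq_mul, Finset.prod_mul_distrib]
  ac_rfl

lemma chi_add_right (μ : DualGrp a b N) (g h : Grp a b N) :
    chi μ (g + h) = chi μ g * chi μ h := by
  simp only [chi, Prod.fst_add, Prod.snd_add, Pi.add_apply, smul_add, add_smul, mul_add,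
    AddCircle.toCircle_add, AddChar.map_add_eq_mul, Finset.prod_mul_distrib]
  ac_rfl

/-- A (not necessarily normalizable) state `∫ ψ(g) |g⟩ dg` in the group-element basis
`{|g⟩ : g ∈ G}`, given by its wavefunction, that is by its coefficients `ψ(g)`. -/
abbrev Wave (a b : ℕ) {c : ℕ} (N : Fin c → ℕ) : Type := Grp a b N → ℂ

/-- The basis state `|g⟩`. -/
def ket (g : Grp a b N) : Wave a b N := Pi.single g 1

/-- Linear operators with an inverse, acting on states; a group under composition. -/
abbrev Op (a b : ℕ) {c : ℕ} (N : Fin c → ℕ) : Type := Wave a b N ≃ₗ[ℂ] Wave a b N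

/-- The shift `X(g)`, `(X(g)ψ)(x) = ψ(x - g)`. -/
def opX (g : Grp a b N) : Op a b N where
  toFun ψ := fun x => ψ (x - g)
  invFun ψ := fun x => ψ (x + g)
  map_add' _ _ := rfl
  map_smul' _ _ := rfl
  left_inv ψ := by ext x; simp
  right_inv ψ := by ext x; simp

/-- The diagonal operator `Z(μ)`, `(Z(μ)ψ)(x) = χ_μ(x) ψ(x)`. -/
def opZ (μ : DualGrp a b N) : Op a b N where
  toFun ψ := fun x => (chi μ x : ℂ) * ψ x
  invFun ψ := fun x => (chi μ x : ℂ)⁻¹ * ψ x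
  map_add' _ _ := by ext x; simp [mul_add]
  map_smul' _ _ := by ext x; simp [mul_left_comm]
  left_inv ψ := by ext x; simp
  right_inv ψ := by ext x; simp

/-- Multiplication by a phase `γ`, `|γ| = 1`. -/
def opPhase (γ : Circle) : Op a b N where
  toFun ψ := fun x => (γ : ℂ) * ψ x
  invFun ψ := fun x => (γ : ℂ)⁻¹ * ψ x
  map_add' _ _ := by ext x; simp [mul_add]
  map_smul' _ _ := by ext x; simp [mul_left_comm]
  left_inv ψ := by ext x; simp
  right_inv ψ := by ext x; simp

/-- The Pauli operator `γ Z(μ) X(g)` with phase `γ` and label `(μ, g)`. -/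
def pauli (γ : Circle) (μ : DualGrp a b N) (g : Grp a b N) : Op a b N :=
  opPhase γ * opZ μ * opX g

/-- `S` is a stabilizer group: a group of commuting Pauli operators whose common
`+1` eigenspace is nontrivial. -/
def IsStabilizerGroup (S : Subgroup (Op a b N)) : Prop :=
  (∀ σ ∈ S, ∃ (γ : Circle) (μ : DualGrp a b N) (g : Grp a b N), σ = pauli γ μ g) ∧
  (∀ σ ∈ S, ∀ τ ∈ S, σ * τ = τ * σ) ∧
  ∃ ψ : Wave a b N, ψ ≠ 0 ∧ ∀ σ ∈ S, σ ψ = ψ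

/-- `ψ` is a stabilizer state with stabilizer group `S`: it is the unique common `+1`
eigenstate of `S`, up to normalization. -/
def IsStabilizerState (S : Subgroup (Op a b N)) (ψ : Wave a b N) : Prop :=
  IsStabilizerGroup S ∧ ψ ≠ 0 ∧ (∀ σ ∈ S, σ ψ = ψ) ∧
  ∀ φ : Wave a b N, (∀ σ ∈ S, σ φ = φ) → ∃ z : ℂ, φ = z • ψ

lemma pauli_apply (γ : Circle) (μ : DualGrp a b N) (g : Grp a b N) (ψ : Wave a b N)
    (x : Grp a b N) : pauli γ μ g ψ x = (γ : ℂ) * ((chi μ x : ℂ) * ψ (x - g)) := rfl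

lemma pauli_one : pauli 1 (0 : DualGrp a b N) (0 : Grp a b N) = 1 := by
  ext ψ x
  simp [pauli_apply, chi_zero_left]

lemma pauli_mul (γ δ : Circle) (μ ν : DualGrp a b N) (g h : Grp a b N) :
    pauli γ μ g * pauli δ ν h = pauli (γ * δ * (chi ν g)⁻¹) (μ + ν) (g + h) := by
  ext ψ x
  have h1 : (chi ν x : ℂ) = chi ν (x - g) * chi ν g := by
    rw [← Circle.coe_mul, ← chi_add_right, sub_add_cancel]
  rw [LinearEquiv.mul_apply, pauli_apply, pauli_apply, pauli_apply, chi_add_left,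
    Circle.coe_mul, Circle.coe_mul, Circle.coe_mul, Circle.coe_inv, h1, sub_sub]
  have h2 : (chi ν g : ℂ) ≠ 0 := Circle.coe_ne_zero _
  field_simp

lemma pauli_inv (γ : Circle) (μ : DualGrp a b N) (g : Grp a b N) :
    (pauli γ μ g)⁻¹ = pauli (γ⁻¹ * chi (-μ) g) (-μ) (-g) := by
  rw [inv_eq_iff_mul_eq_one, pauli_mul, add_neg_cancel, add_neg_cancel, ← pauli_one]
  congr 1
  simp

/-- The label group `ℍ` of `S`: all `g ∈ G` such that `S` contains some `γ Z(μ) X(g)`. -/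
def labelH (S : Subgroup (Op a b N)) : AddSubgroup (Grp a b N) where
  carrier := {g | ∃ (γ : Circle) (μ : DualGrp a b N), pauli γ μ g ∈ S}
  zero_mem' := ⟨1, 0, by rw [pauli_one]; exact S.one_mem⟩
  add_mem' := by
    rintro g h ⟨γ, μ, h1⟩ ⟨δ, ν, h2⟩
    exact ⟨_, _, pauli_mul γ δ μ ν g h ▸ S.mul_mem h1 h2⟩
  neg_mem' := by
    rintro g ⟨γ, μ, h1⟩
    exact ⟨_, _, pauli_inv γ μ g ▸ S.inv_mem h1⟩

/-- The diagonal label group `𝔻` of `S`: all `μ ∈ G^*` such that `S` contains some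
`γ Z(μ)`. -/
def labelD (S : Subgroup (Op a b N)) : AddSubgroup (DualGrp a b N) where
  carrier := {μ | ∃ γ : Circle, pauli γ μ 0 ∈ S}
  zero_mem' := ⟨1, by rw [pauli_one]; exact S.one_mem⟩
  add_mem' := by
    rintro μ ν ⟨γ, h1⟩ ⟨δ, h2⟩
    have h3 := pauli_mul γ δ μ ν 0 0 ▸ S.mul_mem h1 h2
    rw [add_zero] at h3
    exact ⟨_, h3⟩
  neg_mem' := by
    rintro μ ⟨γ, h1⟩
    have h3 := pauli_inv γ μ 0 ▸ S.inv_mem h1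
    rw [neg_zero] at h3
    exact ⟨_, h3⟩

/-- The diagonal Pauli operators in `S`. -/
def diagonalPaulis (S : Subgroup (Op a b N)) : Set (Op a b N) :=
  {σ | σ ∈ S ∧ ∃ (γ : Circle) (μ : DualGrp a b N), σ = pauli γ μ 0}

/-- The annihilator `Y^⊥ = {x ∈ G : χ_μ(x) = 1 for all μ ∈ Y}` of a set `Y ⊆ G^*`. -/
def annihilator (Y : Set (DualGrp a b N)) : Set (Grp a b N) :=
  {x | ∀ μ ∈ Y, chi μ x = 1}

end AbelianStabilizer

end

open scoped ComplexConjugate Pointwise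

namespace AbelianStabilizer

variable {a b c : ℕ} {N : Fin c → ℕ} [∀ i, NeZero (N i)]

/-! Let `F` be the set of points whose basis states are fixed by all diagonal elements of `S`.
Evaluating the fixing equations of `ψ` pointwise gives `supp ψ ⊆ F` and makes `|ψ|` invariant under
translation by `ℍ`. Uniqueness of `ψ` then enters twice. Restricting `ψ` to a coset of `ℍ` keeps it
fixed, so the support is a single coset (`IsStabilizerState.support_eq`). Over each `x ∈ F` there is
a fixed wavefunction that is nonzero at `x`, so `F ⊆ supp ψ` (`exists_fixed_wave`). Comparing the
two descriptions of the support gives `ℍ = 𝔻^⊥`, and continuity of characters gives closedness. -/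

lemma chi_neg_left (μ : DualGrp a b N) (g : Grp a b N) : chi (-μ) g = (chi μ g)⁻¹ := by
  rw [eq_inv_iff_mul_eq_one, ← chi_add_left, neg_add_cancel, chi_zero_left]

lemma chi_neg_right (μ : DualGrp a b N) (g : Grp a b N) : chi μ (-g) = (chi μ g)⁻¹ := by
  rw [eq_inv_iff_mul_eq_one, ← chi_add_right, neg_add_cancel, chi_zero_right]

lemma chi_sub_right (μ : DualGrp a b N) (g h : Grp a b N) :
    chi μ (g - h) = chi μ g * (chi μ h)⁻¹ := by
  rw [sub_eq_add_neg, chi_add_right, chi_neg_right]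

lemma continuous_chi (μ : DualGrp a b N) : Continuous (chi μ) := by
  unfold chi
  refine (Continuous.mul ?_ ?_).mul ?_
  · refine continuous_finsetProd _ fun i _ => AddCircle.continuous_toCircle.comp ?_
    exact (continuous_of_discreteTopology (f := fun n : ℤ => n • μ.1 i)).comp
      ((continuous_apply i).comp continuous_fst)
  · refine continuous_finsetProd _ fun j _ => AddCircle.continuous_toCircle.comp ?_
    exact (continuous_zsmul _).comp ((continuous_apply j).comp continuous_snd.fst)
  · refine continuous_finsetProd _ fun k _ => ?_
    exact (continuous_of_discreteTopology
      (f := fun z : ZMod (N k) => ZMod.toCircle (μ.2.2 k * z))).comp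
      ((continuous_apply k).comp continuous_snd.snd)

lemma isClosed_annihilator (Y : Set (DualGrp a b N)) : IsClosed (annihilator Y) := by
  simp only [annihilator, Set.ofPred_forall]
  exact isClosed_biInter fun μ _ => isClosed_eq (continuous_chi μ) continuous_const

lemma pauli_zero_ket (γ : Circle) (μ : DualGrp a b N) (x : Grp a b N) :
    pauli γ μ 0 (ket x) = ket x ↔ γ * chi μ x = 1 := by
  constructor
  · intro h
    have := congrFun h x
    simp only [pauli_apply, sub_zero, ket, Pi.single_eq_same, mul_one] at this
    exact Circle.coe_injective (by simpa using this)
  · intro h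
    ext y
    rw [pauli_apply, sub_zero]
    rcases eq_or_ne y x with rfl | hy
    · rw [← mul_assoc, ← Circle.coe_mul, h, Circle.coe_one, one_mul]
    · simp [ket, Pi.single_eq_of_ne hy]

/-- The points `x` whose basis state `|x⟩` is fixed by every diagonal Pauli operator in `S`. -/
def diagonalFixedPoints (S : Subgroup (Op a b N)) : Set (Grp a b N) :=
  {x | ∀ (γ : Circle) (μ : DualGrp a b N), pauli γ μ 0 ∈ S → γ * chi μ x = 1}

lemma mem_diagonalFixedPoints_iff {S : Subgroup (Op a b N)} {x : Grp a b N} :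
    x ∈ diagonalFixedPoints S ↔ ∀ σ ∈ diagonalPaulis S, σ (ket x) = ket x := by
  constructor
  · rintro h _ ⟨hσ, γ, μ, rfl⟩
    exact (pauli_zero_ket γ μ x).2 (h γ μ hσ)
  · exact fun h γ μ hσ => (pauli_zero_ket γ μ x).1 (h _ ⟨hσ, γ, μ, rfl⟩)

lemma pauli_div_mem {S : Subgroup (Op a b N)} {γ δ : Circle} {μ ν : DualGrp a b N}
    {h : Grp a b N} (h1 : pauli γ μ h ∈ S) (h2 : pauli δ ν h ∈ S) :
    pauli (γ * δ⁻¹) (μ + -ν) 0 ∈ S := by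
  have h3 := S.mul_mem h1 (S.inv_mem h2)
  rwa [pauli_inv, pauli_mul, add_neg_cancel, ← mul_assoc, mul_inv_cancel_right] at h3

lemma norm_sub_of_mem_labelH {S : Subgroup (Op a b N)} {ψ : Wave a b N}
    (hfix : ∀ σ ∈ S, σ ψ = ψ) {h : Grp a b N} (hh : h ∈ labelH S) (x : Grp a b N) :
    ‖ψ (x - h)‖ = ‖ψ x‖ := by
  obtain ⟨γ, μ, hσ⟩ := hh
  have := congrFun (hfix _ hσ) x
  rw [pauli_apply] at this
  simpa only [norm_mul, Circle.norm_coe, one_mul] using congrArg norm this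

lemma norm_add_of_mem_labelH {S : Subgroup (Op a b N)} {ψ : Wave a b N}
    (hfix : ∀ σ ∈ S, σ ψ = ψ) {h : Grp a b N} (hh : h ∈ labelH S) (x : Grp a b N) :
    ‖ψ (x + h)‖ = ‖ψ x‖ := by
  simpa using norm_sub_of_mem_labelH hfix (neg_mem hh) x

lemma support_subset_diagonalFixedPoints {S : Subgroup (Op a b N)} {ψ : Wave a b N}
    (hfix : ∀ σ ∈ S, σ ψ = ψ) :
    Function.support ψ ⊆ diagonalFixedPoints S := by
  intro x hx γ μ hσ
  have := congrFun (hfix _ hσ) x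
  rw [pauli_apply, sub_zero, ← mul_assoc] at this
  exact Circle.coe_injective (by simpa using mul_right_cancel₀ hx (this.trans (one_mul _).symm))

/-- A point `s` of the support and its translate `s + h` both lie in `F`, so `γ χ_μ` equals 1 at
both; divide. -/
lemma chi_eq_one_of_mem {S : Subgroup (Op a b N)} {ψ : Wave a b N}
    (hfix : ∀ σ ∈ S, σ ψ = ψ) (hne : ψ ≠ 0) {h : Grp a b N} (hh : h ∈ labelH S)
    {μ : DualGrp a b N} (hμ : μ ∈ labelD S) : chi μ h = 1 := by
  obtain ⟨γ, hσ⟩ := hμ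
  obtain ⟨s, hs⟩ := Function.ne_iff.1 hne
  have hs' : s + h ∈ Function.support ψ := by
    rw [Function.mem_support, ← norm_ne_zero_iff, norm_add_of_mem_labelH hfix hh]
    exact norm_ne_zero_iff.2 hs
  have h1 := support_subset_diagonalFixedPoints hfix hs γ μ hσ
  have h2 := support_subset_diagonalFixedPoints hfix hs' γ μ hσ
  rwa [chi_add_right, ← mul_assoc, h1, one_mul] at h2

lemma IsStabilizerState.support_eq {S : Subgroup (Op a b N)} {ψ : Wave a b N}
    (hψ : IsStabilizerState S ψ) {s : Grp a b N} (hs : s ∈ Function.support ψ) :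
    Function.support ψ = s +ᵥ (labelH S : Set (Grp a b N)) := by
  classical
  obtain ⟨⟨hP, -, -⟩, -, hfix, huniq⟩ := hψ
  ext x
  rw [Set.mem_vadd_set_iff_neg_vadd_mem, vadd_eq_add, neg_add_eq_sub, SetLike.mem_coe]
  constructor
  · intro hx
    -- Every element of `S` shifts by an element of `ℍ`, so it preserves cosets and fixes the
    -- truncation of `ψ` to `s + ℍ`.
    obtain ⟨z, hz⟩ := huniq (fun y => if y - s ∈ labelH S then ψ y else 0) (by
      intro σ hσ
      obtain ⟨γ, μ, g, rfl⟩ := hP σ hσ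
      have hg : g ∈ labelH S := ⟨γ, μ, hσ⟩
      ext y
      have hy := congrFun (hfix _ hσ) y
      rw [pauli_apply] at hy ⊢
      have hiff : y - g - s ∈ labelH S ↔ y - s ∈ labelH S := by
        rw [sub_right_comm]
        exact ⟨fun h => by simpa using add_mem h hg, fun h => sub_mem h hg⟩
      simp only [hiff]
      split_ifs
      · exact hy
      · simp)
    have hz0 : z ≠ 0 := by
      rintro rfl
      have := congrFun hz s
      simp only [sub_self, zero_mem, if_true, zero_smul, Pi.zero_apply] at this
      exact hs this
    by_contra hxs
    have := congrFun hz x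
    simp only [hxs, if_false, Pi.smul_apply, smul_eq_mul] at this
    exact mul_ne_zero hz0 hx this.symm
  · intro hx
    have := norm_add_of_mem_labelH hfix hx s
    rw [add_sub_cancel] at this
    rw [Function.mem_support, ← norm_ne_zero_iff, this]
    exact norm_ne_zero_iff.2 hs

/-- Over a point `x` fixed by all diagonal operators, the stabilizer group fixes a wavefunction
that does not vanish at `x`. -/
lemma exists_fixed_wave {S : Subgroup (Op a b N)}
    (hP : ∀ σ ∈ S, ∃ (γ : Circle) (μ : DualGrp a b N) (g : Grp a b N), σ = pauli γ μ g)
    (hchi : ∀ h ∈ labelH S, ∀ μ ∈ labelD S, chi μ h = 1)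
    {x : Grp a b N} (hx : x ∈ diagonalFixedPoints S) :
    ∃ φ : Wave a b N, (∀ σ ∈ S, σ φ = φ) ∧ φ x ≠ 0 := by
  classical
  -- Two elements of `S` with the same shift differ by a diagonal one. Its character takes the same
  -- value at `y` as at `x`, since `y - x ∈ ℍ`, and `x ∈ F` makes phase times value 1.
  have key {y : Grp a b N} {γ δ : Circle} {μ ν : DualGrp a b N}
      (h1 : pauli γ μ (y - x) ∈ S) (h2 : pauli δ ν (y - x) ∈ S) :
      γ * chi μ y = δ * chi ν y := by
    have h3 := pauli_div_mem h1 h2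
    have h4 := hx _ _ h3
    have h5 := hchi (y - x) ⟨γ, μ, h1⟩ _ ⟨_, h3⟩
    have h6 : chi (μ + -ν) y = chi (μ + -ν) x := by
      rw [← add_sub_cancel x y, chi_add_right, h5, mul_one]
    rw [← h6, chi_add_left, chi_neg_left, mul_mul_mul_comm, ← mul_inv, mul_inv_eq_one] at h4
    exact h4
  choose! γ μ hγμ using fun (h : Grp a b N) (hh : h ∈ labelH S) =>
    (show ∃ (γ : Circle) (μ : DualGrp a b N), pauli γ μ h ∈ S from hh)
  -- The value at `y` is the coefficient of `|y⟩` in `γ Z(μ) X(y - x)|x⟩`; by `key` it does not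
  -- depend on the chosen Pauli operator.
  refine ⟨fun y => if y - x ∈ labelH S then
    ((γ (y - x) * chi (μ (y - x)) y : Circle) : ℂ) else 0, ?_, by simp [zero_mem]⟩
  intro σ hσ
  obtain ⟨δ, ν, g, rfl⟩ := hP σ hσ
  have hg : g ∈ labelH S := ⟨δ, ν, hσ⟩
  ext y
  rw [pauli_apply]
  have hiff : y - g - x ∈ labelH S ↔ y - x ∈ labelH S := by
    rw [sub_right_comm]
    exact ⟨fun h => by simpa using add_mem h hg, fun h => sub_mem h hg⟩
  by_cases hy : y - x ∈ labelH S
  · have hy' := hiff.2 hy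
    simp only [hy, hy', if_true]
    -- The product of `σ` with the operator chosen for `y - g - x` has shift `y - x`, so `key`
    -- compares it with the one chosen there.
    have hm := S.mul_mem hσ (hγμ _ hy')
    rw [pauli_mul, show g + (y - g - x) = y - x by abel] at hm
    rw [← key hm (hγμ _ hy), ← Circle.coe_mul, ← Circle.coe_mul, chi_sub_right, chi_add_left]
    congr 1
    ac_rfl
  · simp [hiff, hy]

lemma IsStabilizerState.support_eq_diagonalFixedPoints {S : Subgroup (Op a b N)} {ψ : Wave a b N}
    (hψ : IsStabilizerState S ψ) : Function.support ψ = diagonalFixedPoints S := by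
  obtain ⟨⟨hP, -, -⟩, hne, hfix, huniq⟩ := hψ
  refine (support_subset_diagonalFixedPoints hfix).antisymm fun x hx => ?_
  obtain ⟨φ, hφ, hφx⟩ := exists_fixed_wave hP
    (fun h hh μ hμ => chi_eq_one_of_mem hfix hne hh hμ) hx
  obtain ⟨z, rfl⟩ := huniq φ hφ
  exact right_ne_zero_of_mul hφx

/-- For the inclusion `𝔻^⊥ ⊆ ℍ`: translating by `h ∈ 𝔻^⊥` keeps `s` inside `F = supp ψ = s + ℍ`. -/
lemma IsStabilizerState.labelH_eq_annihilator {S : Subgroup (Op a b N)} {ψ : Wave a b N}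
    (hψ : IsStabilizerState S ψ) :
    (labelH S : Set (Grp a b N)) = annihilator (labelD S : Set (DualGrp a b N)) := by
  obtain ⟨-, hne, hfix, -⟩ := id hψ
  refine Set.Subset.antisymm (fun h hh μ hμ => chi_eq_one_of_mem hfix hne hh hμ) fun h hh => ?_
  obtain ⟨s, hs⟩ := Function.ne_iff.1 hne
  have hsh : s + h ∈ Function.support ψ := by
    rw [hψ.support_eq_diagonalFixedPoints]
    intro γ μ hσ
    rw [chi_add_right, hh μ ⟨γ, hσ⟩, mul_one]
    exact support_subset_diagonalFixedPoints hfix hs γ μ hσ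
  rw [hψ.support_eq hs, Set.mem_vadd_set_iff_neg_vadd_mem, vadd_eq_add, neg_add_cancel_left] at hsh
  exact hsh

lemma isClosed_diagonalFixedPoints (S : Subgroup (Op a b N)) :
    IsClosed (diagonalFixedPoints S) := by
  simp only [diagonalFixedPoints, Set.ofPred_forall]
  exact isClosed_iInter fun γ => isClosed_iInter fun μ => isClosed_iInter fun _ =>
    isClosed_eq (continuous_const.mul (continuous_chi μ)) continuous_const

end AbelianStabilizer

theorem mainTheorem9 {a b c : ℕ} (N : Fin c → ℕ) [∀ i, NeZero (N i)]
    (S : Subgroup (AbelianStabilizer.Op a b N)) (ψ : AbelianStabilizer.Wave a b N)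
    (hψ : AbelianStabilizer.IsStabilizerState S ψ) :
    -- `ψ` is a uniform superposition over a coset `s + ℍ`
    (∃ (s : AbelianStabilizer.Grp a b N) (r : ℝ), 0 < r ∧
      Function.support ψ = s +ᵥ (AbelianStabilizer.labelH S : Set (AbelianStabilizer.Grp a b N)) ∧
      ∀ h ∈ AbelianStabilizer.labelH S, ‖ψ (s + h)‖ = r) ∧
    -- `x` is in the support iff every diagonal Pauli operator of `S` fixes `|x⟩`
    (∀ x : AbelianStabilizer.Grp a b N, x ∈ Function.support ψ ↔
      ∀ σ ∈ AbelianStabilizer.diagonalPaulis S,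
        σ (AbelianStabilizer.ket x) = AbelianStabilizer.ket x) ∧
    -- the phase `γ_μ` is determined by `μ ∈ 𝔻`, and `supp ψ = {x | χ_μ(x) = conj γ_μ, μ ∈ 𝔻}`
    (∃ γ : AbelianStabilizer.labelD S → Circle,
      (∀ (μ : AbelianStabilizer.labelD S) (δ : Circle),
        AbelianStabilizer.pauli δ (μ : AbelianStabilizer.DualGrp a b N) 0 ∈ S ↔ δ = γ μ) ∧
      Function.support ψ =
        {x | ∀ μ : AbelianStabilizer.labelD S,
          (AbelianStabilizer.chi (μ : AbelianStabilizer.DualGrp a b N) x : ℂ) =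
            conj (γ μ : ℂ)}) ∧
    -- `ℍ = 𝔻^⊥`, and `ℍ` and the support are closed
    (AbelianStabilizer.labelH S : Set (AbelianStabilizer.Grp a b N)) =
      AbelianStabilizer.annihilator
        (AbelianStabilizer.labelD S : Set (AbelianStabilizer.DualGrp a b N)) ∧
    IsClosed (AbelianStabilizer.labelH S : Set (AbelianStabilizer.Grp a b N)) ∧
    IsClosed (Function.support ψ) := by
  obtain ⟨-, hne, hfix, -⟩ := id hψ
  obtain ⟨s, hs⟩ := Function.ne_iff.1 hne
  have hsupp := hψ.support_eq_diagonalFixedPoints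
  refine ⟨⟨s, ‖ψ s‖, norm_pos_iff.2 hs, hψ.support_eq hs,
    fun h hh => AbelianStabilizer.norm_add_of_mem_labelH hfix hh s⟩, fun x => ?_, ?_,
    hψ.labelH_eq_annihilator, ?_, ?_⟩
  · rw [hsupp, AbelianStabilizer.mem_diagonalFixedPoints_iff]
  · have hsF := AbelianStabilizer.support_subset_diagonalFixedPoints hfix hs
    choose γ hγ using fun μ : AbelianStabilizer.labelD S =>
      (show ∃ γ : Circle, AbelianStabilizer.pauli γ μ.1 0 ∈ S from μ.2)
    -- The single point `s ∈ F` forces the phase to be `χ_μ(s)⁻¹`.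
    have huniq (μ : AbelianStabilizer.labelD S) (δ : Circle)
        (hδ : AbelianStabilizer.pauli δ μ.1 0 ∈ S) : δ = γ μ :=
      mul_right_cancel ((hsF _ _ hδ).trans (hsF _ _ (hγ μ)).symm)
    refine ⟨γ, fun μ δ => ⟨huniq μ δ, fun h => h ▸ hγ μ⟩, ?_⟩
    rw [hsupp]
    ext x
    have hconj (μ : AbelianStabilizer.labelD S) :
        (AbelianStabilizer.chi μ.1 x : ℂ) = conj (γ μ : ℂ) ↔
          γ μ * AbelianStabilizer.chi μ.1 x = 1 := by
      rw [← Circle.coe_inv_eq_conj, Circle.coe_inj, eq_inv_iff_mul_eq_one, mul_comm]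
    simp only [Set.mem_ofPred_eq, hconj]
    refine ⟨fun hx μ => hx _ _ (hγ μ), fun hx δ μ hδ => ?_⟩
    rw [huniq ⟨μ, δ, hδ⟩ δ hδ]
    exact hx ⟨μ, δ, hδ⟩
  · rw [hψ.labelH_eq_annihilator]
    exact AbelianStabilizer.isClosed_annihilator _
  · rw [hsupp]
    exact AbelianStabilizer.isClosed_diagonalFixedPoints S
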